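/- A hypergraph $H$ has a finite vertex set $V(H)\neq\emptyset$ and a set $E(H)$ of non-empty subsets of $V(H)$ (hyperedges; the arity of a hyperedge is its size). Let $l\in\{0,1,2,\dots\}\cup\{\infty\}$. For $S\subseteq V(H)$ the induced $l$-trimmed subhypergraph $H\langle S\rangle_l$ has vertex set $S$ and hyperedge set $\{e\cap S : e\in E(H),\ |e\setminus S|\le l,\ e\cap S\ne\emptyset\}$. For an ordering $\pi$ of $V(H)$, the $l$-skeleton is the directed acyclic graph on $V(H)$ that has, for every hyperedge $e$, an edge from each of the first $l+1$ vertices of $e$ (in the order $\pi$) to every later vertex of $e$. In a directed acyclic graph $\vec G$, a source is a vertex without incoming edges, $\mathrm{Reach}(s)$ is the set of the vertices reachable from $s$ by a directed path (including $s$), and $\mathrm{Reach}(B)=\bigcup_{s\in B}\mathrm{Reach}(s)$. A DAG-tree decomposition of $\vec G$ is a rooted tree whose nodes are sets of sources such that every source lies in some node and $\mathrm{Reach}(B_1)\cap \mathrm{Reach}(B_2)\subseteq \mathrm{Reach}(B)$ whenever the node $B$ lies on the path between the nodes $B_1$ and $B_2$. Its width is the maximum size of a node, and the DAG-treewidth of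 $\vec G$ is the minimum width of a DAG-tree decomposition of $\vec G$. The $l$-DAG-treewidth $\tau_l(H)$ is the maximum, over all orderings of $V(H)$, of the DAG-treewidth of the $l$-skeleton. Two vertices are adjacent in a hypergraph if some hyperedge contains both, and connected components are taken with respect to this adjacency. A hypergraph $H'$ is an $l$-obstruction if for some $k\ge 3$ there is a set $C\subseteq V(H')$ with $|C|=k$ such that, with $D_1,D_2,\dots$ the vertex sets of the connected components of $H'\langle V(H')\setminus C\rangle_\infty$ and $E_i=\{e\in E(H') : e\subseteq C\cup D_i,\ |e|>1\}$: (1) every hyperedge of $H'\langle C\rangle_l$ has arity $1$; (2) for every $i$, $C\not\subseteq\bigcup_{e\in E_i}e$; (3) for every $c\in C$ there is an $i$ with $C\cap\bigcup_{e\in E_i}e=C\setminus\{c\}$. Let $\mathcal H_l$ be the set of all $l$-obstructions. $H$ is $\mathcal H_l$ ITS free if no $H\langle S\rangle_\infty$ with $S\subseteq V(H)$ belongs to $\mathcal H_l$. Theorem. For every $l\in\{0,1,2,\dots\}\cup\{\infty\}$ and every hypergraph $H$, $\tau_l(H)=1$ if and only if $H$ is $\mathcal H_l$ ITS free. -/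

import Mathlib

open scoped Hypergraph

namespace Digraph

variable {V : Type*}

/-- The vertices with no incoming edge. -/
def sources (D : Digraph V) : Set V := {v | ∀ u, ¬ D.Adj u v}

/-- The vertices that can be reached from `s` by a directed path (of length `0` or more). -/
def reach (D : Digraph V) (s : V) : Set V := {v | Relation.ReflTransGen D.Adj s v}

/-- The vertices that can be reached from some vertex of `B`. -/
def reachSet (D : Digraph V) (B : Finset V) : Set V := ⋃ s ∈ B, D.reach s

/-- A DAG-tree decomposition: a rooted tree whose nodes are sets of sources. -/
structure DagTreeDecomposition (D : Digraph V) where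
  /-- the nodes of the tree -/
  bags : Finset (Finset V)
  /-- the tree on the nodes -/
  tree : SimpleGraph bags
  /-- the root -/
  root : bags
  isTree : tree.IsTree
  bag_subset : ∀ B : bags, ∀ s ∈ B.1, s ∈ D.sources
  cover : ∀ s ∈ D.sources, ∃ B : bags, s ∈ B.1
  reach_inter : ∀ (B B₁ B₂ : bags) (p : tree.Walk B₁ B₂), p.IsPath → B ∈ p.support →
    D.reachSet B₁.1 ∩ D.reachSet B₂.1 ⊆ D.reachSet B.1

/-- The width of a decomposition: the largest size of a node. -/
def DagTreeDecomposition.width {D : Digraph V} (T : D.DagTreeDecomposition) : ℕ :=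
  T.bags.sup Finset.card

/-- The DAG-treewidth: the least width of a DAG-tree decomposition. -/
noncomputable def dagTreewidth (D : Digraph V) : ℕ∞ :=
  ⨅ T : D.DagTreeDecomposition, (T.width : ℕ∞)

end Digraph

namespace Hypergraph

variable {α : Type*}

/-- The induced `l`-trimmed subhypergraph on `S`: its hyperedges are the nonempty sets `e ∩ S`
for the hyperedges `e` that have at most `l` vertices outside `S`. -/
def trimmed (H : Hypergraph α) (l : ℕ∞) (S : Set α) : Hypergraph α where
  vertexSet := S
  edgeSet := {f | ∃ e ∈ E(H), (e \ S).encard ≤ l ∧ (e ∩ S).Nonempty ∧ f = e ∩ S}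
  subset_vertexSet_of_mem_edgeSet' := by
    rintro f ⟨e, -, -, -, rfl⟩
    exact Set.inter_subset_right

/-- `D` is the vertex set of a connected component of `H`. -/
def IsComponent (H : Hypergraph α) (D : Set α) : Prop :=
  ∃ v ∈ V(H), D = {w ∈ V(H) | Relation.ReflTransGen H.Adj v w}

/-- The hyperedges of arity more than `1` that are contained in `C ∪ D`. -/
def connectorEdges (H : Hypergraph α) (C D : Set α) : Set (Set α) :=
  {e ∈ E(H) | e ⊆ C ∪ D ∧ 1 < e.encard}

/-- The set of `l`-obstructions with vertices in `α`; it is closed under isomorphism.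
The components `D` of the trimmed subhypergraph induced by the complement of the core `C` are
distinct for distinct `c`, because only the one that belongs to `c` misses `c` and no other
vertex of the core. -/
def obstructions (α : Type*) (l : ℕ∞) : Set (Hypergraph α) :=
  {H | ∃ (k : ℕ) (C : Set α), 3 ≤ k ∧ C ⊆ V(H) ∧ C.encard = k ∧
    (∀ f ∈ E(H.trimmed l C), f.encard ≤ 1) ∧
    (∀ D, (H.trimmed ⊤ (V(H) \ C)).IsComponent D → ¬ C ⊆ ⋃₀ H.connectorEdges C D) ∧
    (∀ c ∈ C, ∃ D, (H.trimmed ⊤ (V(H) \ C)).IsComponent D ∧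
      C \ {c} ⊆ ⋃₀ H.connectorEdges C D ∧ c ∉ ⋃₀ H.connectorEdges C D)}

/-- `H` is `F` ITS free, for a set `F` of hypergraphs that is closed under isomorphism:
no induced (`∞`-)trimmed subhypergraph of `H` belongs to `F`. -/
def ITSFree (F : Set (Hypergraph α)) (H : Hypergraph α) : Prop :=
  ∀ S ⊆ V(H), H.trimmed ⊤ S ∉ F

/-- An ordering of the vertices, which turns `H` into a directed acyclic hypergraph. -/
abbrev Orientation (H : Hypergraph α) : Type _ := V(H) ≃ Fin V(H).ncard

/-- The `l`-skeleton: in each hyperedge `e`, each of the first `l + 1` vertices of `e` (those that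
have at most `l` vertices of `e` before them) has an edge to every later vertex of `e`. -/
def skeleton (H : Hypergraph α) (π : H.Orientation) (l : ℕ∞) : Digraph V(H) where
  Adj u v := ∃ e ∈ E(H), u.1 ∈ e ∧ v.1 ∈ e ∧ π u < π v ∧
    {w : V(H) | w.1 ∈ e ∧ π w < π u}.encard ≤ l

/-- The `l`-DAG-treewidth of `H`: the maximum, over all orderings of the vertices, of the
DAG-treewidth of the `l`-skeleton. -/
noncomputable def lDagTreewidth (H : Hypergraph α) (l : ℕ∞) : ℕ∞ :=
  ⨆ π : H.Orientation, (H.skeleton π l).dagTreewidth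

end Hypergraph

/-!
A DAG-tree decomposition of width `1` is a join tree of the reach sets of the sources, so what has
to be characterized is that these reach sets form an acyclic hypergraph, for every ordering.

*Acyclicity.* For a finite family of sets and a set `X` of elements, link two members of the family
when they share an element of `X`. A core (`SetFamily.IsCore`) is a set `C` of at least three
elements that the union of no class contains, while each `C \ {c}` is contained in the union of a
class. A family without a core has a join tree (`SetFamily.earOrder_of_forall_not_isCore`): take `X`
maximal with at least two classes. By maximality the union of every class contains the complement
of `X`, and if there is no core, then each class even has a single member that contains the
complement of `X` (`SetFamily.exists_conn_subset`). The family is therefore glued from two smaller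
ones along such members. New cores come from `SetFamily.exists_isCore_insert`: when an element `x`
merges classes that contain `C` only together, `x` and a minimal transversal of the parts of `C`
that the merged classes miss form a core.

*From a core to an obstruction.* The same step moves a core of the reach sets of a directed acyclic
graph towards the sources, until `X` contains all the predecessors of `X ∪ C`
(`Digraph.exists_isCore_closed`). Then the first vertex of every hyperedge with two vertices in
`X ∪ C` lies in `X`, so the components of the trimmed subhypergraph on `X` correspond to the classes
of sources, and a hyperedge with two vertices in `C` has its first `l + 1` vertices in `X`. Hence
`X ∪ C` induces an obstruction with core `C` (`Hypergraph.trimmed_mem_obstructions`).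

*From an obstruction to an ordering.* Given an obstruction on `S` with core `C`, order first
`S \ C`, by the distance from a root in each component, then `C`, then the rest. Each root
reaches exactly the core vertices that its component is attached to, and no source reaches all of
`C`. In a decomposition of width `1`, any two core vertices would be reached from one node, so some
node would reach all of them, by the Helly property of subtrees
(`SimpleGraph.Connected.exists_subset_of_pairwise`), a contradiction.
-/

/-! ### Families of sets without a core have an ear order -/

namespace SetFamily

open Relation

variable {I V : Type*} {R : I → Set V} {J : Finset I} {X Y C : Set V} {s t u : I} {x : V}

/-- Two members of the family `R`, with indices in `J`, are linked through `X` if they share an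
element of `X`. -/
def Linked (R : I → Set V) (J : Finset I) (X : Set V) (s t : I) : Prop :=
  s ∈ J ∧ t ∈ J ∧ ∃ x ∈ X, x ∈ R s ∧ x ∈ R t

/-- `s` and `t` lie in the same class of the equivalence relation generated by `Linked`. -/
def Conn (R : I → Set V) (J : Finset I) (X : Set V) : I → I → Prop :=
  ReflTransGen (Linked R J X)

/-- The union of the members of the family in the class of `s`. -/
def nbhd (R : I → Set V) (J : Finset I) (X : Set V) (s : I) : Set V :=
  {v | ∃ t, Conn R J X s t ∧ v ∈ R t}

/-- The obstruction to acyclicity of the family `R s`, for `s ∈ J`: a set `C` of at least three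
elements that is not contained in the union of any class with respect to `X`, while each `C \ {c}`
is. It follows that `C` and `X` are disjoint (`IsCore.disjoint`). -/
def IsCore (R : I → Set V) (J : Finset I) (C X : Set V) : Prop :=
  3 ≤ C.ncard ∧ (∀ s ∈ J, ¬ C ⊆ nbhd R J X s) ∧ ∀ c ∈ C, ∃ s ∈ J, C \ {c} ⊆ nbhd R J X s

lemma Linked.symm (h : Linked R J X s t) : Linked R J X t s := by
  obtain ⟨h1, h2, x, hx, h3, h4⟩ := h
  exact ⟨h2, h1, x, hx, h4, h3⟩

lemma Conn.symm (h : Conn R J X s t) : Conn R J X t s :=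
  have : Std.Symm (Linked R J X) := ⟨fun _ _ h => h.symm⟩
  ReflTransGen.stdSymm.symm _ _ h

lemma Conn.mem (h : Conn R J X s t) (hs : s ∈ J) : t ∈ J := by
  induction h with
  | refl => exact hs
  | tail _ h _ => exact h.2.1

lemma Conn.mono (h : Conn R J X s t) (hXY : X ⊆ Y) : Conn R J Y s t :=
  ReflTransGen.mono (fun _ _ ⟨h1, h2, x, hx, h3⟩ => ⟨h1, h2, x, hXY hx, h3⟩) _ _ h

lemma Conn.nbhd_subset (h : Conn R J X s t) : nbhd R J X t ⊆ nbhd R J X s :=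
  fun _ ⟨u, hu, hv⟩ => ⟨u, h.trans hu, hv⟩

lemma nbhd_mono (hXY : X ⊆ Y) : nbhd R J X s ⊆ nbhd R J Y s :=
  fun _ ⟨u, hu, hv⟩ => ⟨u, hu.mono hXY, hv⟩

lemma subset_nbhd : R s ⊆ nbhd R J X s := fun _ hv => ⟨s, .refl, hv⟩

lemma conn_of_mem_nbhd (hs : s ∈ J) (ht : t ∈ J) (hx : x ∈ X) (hxs : x ∈ nbhd R J X s)
    (hxt : x ∈ nbhd R J X t) : Conn R J X s t := by
  obtain ⟨s', hs', h1⟩ := hxs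
  obtain ⟨t', ht', h2⟩ := hxt
  exact (hs'.tail ⟨hs'.mem hs, ht'.mem ht, x, hx, h1, h2⟩).trans ht'.symm

/-- Adding `x` to `X` only merges the classes whose union contains `x`. -/
lemma Conn.of_insert (h : Conn R J (insert x X) s t) :
    Conn R J X s t ∨ x ∈ nbhd R J X s ∧ x ∈ nbhd R J X t := by
  induction h with
  | refl => exact .inl .refl
  | @tail t u _ h ih =>
    obtain ⟨ht, hu, y, hy, hyt, hyu⟩ := h
    rcases hy with rfl | hy
    · right
      refine ⟨?_, subset_nbhd hyu⟩
      rcases ih with ih | ih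
      · exact ⟨t, ih, hyt⟩
      · exact ih.1
    · have hl : Conn R J X t u := .single ⟨ht, hu, y, hy, hyt, hyu⟩
      rcases ih with ih | ih
      · exact .inl (ih.trans hl)
      · exact .inr ⟨ih.1, hl.symm.nbhd_subset ih.2⟩

/-- If adding `x` to `X` makes `C` covered by the class of `t`, then `t` is in one of the classes
merged by `x`, and the merged classes together cover `C`. -/
lemma mem_nbhd_of_subset_nbhd_insert (h : ¬ C ⊆ nbhd R J X t)
    (h' : C ⊆ nbhd R J (insert x X) t) (ht : t ∈ J) :
    x ∈ nbhd R J X t ∧ ∀ c ∈ C, ∃ d ∈ J, x ∈ nbhd R J X d ∧ c ∈ nbhd R J X d := by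
  have hxt : x ∈ nbhd R J X t := by
    obtain ⟨c, hc, hct⟩ := Set.not_subset.1 h
    obtain ⟨u, hu, hcu⟩ := h' hc
    rcases hu.of_insert with h1 | h1
    · exact absurd ⟨u, h1, hcu⟩ hct
    · exact h1.1
  refine ⟨hxt, fun c hc => ?_⟩
  obtain ⟨u, hu, hcu⟩ := h' hc
  rcases hu.of_insert with h1 | h1
  · exact ⟨t, ht, hxt, u, h1, hcu⟩
  · exact ⟨u, hu.mem ht, h1.2, subset_nbhd hcu⟩

/-- The source of new cores: if the classes containing `x` cover `C` together but not one by one,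
and some class without `x` covers `C`, then `x` and a part of `C` form a core. That part is a
minimal transversal of the sets `C \ nbhd d`, for the classes of `d` that contain `x`. -/
lemma exists_isCore_insert [Finite V] (hxC : x ∉ C) (ht : t ∈ J) (hxt : x ∈ nbhd R J X t)
    (hD : ∀ d ∈ J, x ∈ nbhd R J X d → ¬ C ⊆ nbhd R J X d)
    (hcov : ∀ c ∈ C, ∃ d ∈ J, x ∈ nbhd R J X d ∧ c ∈ nbhd R J X d)
    (hz : ∃ z ∈ J, x ∉ nbhd R J X z ∧ C ⊆ nbhd R J X z) :
    ∃ C' ⊆ C, IsCore R J (insert x C') X := by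
  classical
  let P : Set (Set V) :=
    {A | A ⊆ C ∧ ∀ d ∈ J, x ∈ nbhd R J X d → ∃ c ∈ A, c ∉ nbhd R J X d}
  have hP : P.Nonempty := ⟨C, subset_rfl, fun d hd hxd => Set.not_subset.1 (hD d hd hxd)⟩
  obtain ⟨A, hA⟩ := (Set.toFinite P).exists_minimal hP
  have hAC : A ⊆ C := hA.prop.1
  have hmin : ∀ c ∈ A, ∃ d ∈ J, x ∈ nbhd R J X d ∧ A \ {c} ⊆ nbhd R J X d := by
    intro c hc
    by_contra! hcon
    have : A \ {c} ∈ P := ⟨Set.sdiff_subset.trans hAC, fun d hd hxd =>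
      Set.not_subset.1 (hcon d hd hxd)⟩
    exact (hA.le_of_le this Set.sdiff_subset hc).2 rfl
  refine ⟨A, hAC, ?_, ?_, ?_⟩
  · have hxA : x ∉ A := fun h => hxC (hAC h)
    rw [Set.ncard_insert_of_notMem hxA]
    have : 1 < A.ncard := by
      obtain ⟨c, hc, -⟩ := hA.prop.2 t ht hxt
      obtain ⟨d, hd, hxd, hcd⟩ := hcov c (hAC hc)
      obtain ⟨c', hc', hcd'⟩ := hA.prop.2 d hd hxd
      exact (Set.one_lt_ncard (Set.toFinite A)).2 ⟨c, hc, c', hc', fun h => hcd' (h ▸ hcd)⟩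
    omega
  · intro d hd hsub
    obtain ⟨c, hc, hcd⟩ := hA.prop.2 d hd (hsub (Set.mem_insert _ _))
    exact hcd (hsub (Set.mem_insert_of_mem _ hc))
  · rintro c (rfl | hc)
    · obtain ⟨z, hz, -, hCz⟩ := hz
      refine ⟨z, hz, ?_⟩
      rintro a ⟨rfl | ha, hne⟩
      · exact absurd rfl hne
      · exact hCz (hAC ha)
    · obtain ⟨d, hd, hxd, hsub⟩ := hmin c hc
      refine ⟨d, hd, ?_⟩
      rintro a ⟨rfl | ha, hne⟩
      · exact hxd
      · exact hsub ⟨ha, hne⟩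

/-- An element of a core is in the unions of two different classes. -/
lemma IsCore.exists_not_conn [Finite V] (h : IsCore R J C X) {c : V} (hc : c ∈ C) :
    ∃ u ∈ J, ∃ v ∈ J, c ∈ R u ∧ c ∈ R v ∧ ¬ Conn R J X u v := by
  by_contra! hcon
  have hcard := h.1
  obtain ⟨a, ha, b, hb, hab⟩ := (Set.one_lt_ncard (Set.toFinite (C \ {c}))).1 (by
    rw [Set.ncard_sdiff_singleton_of_mem hc]; omega)
  obtain ⟨s, hs, hsa⟩ := h.2.2 a ha.1
  obtain ⟨t, ht, htb⟩ := h.2.2 b hb.1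
  obtain ⟨u, hu, hcu⟩ := hsa ⟨hc, fun h => ha.2 h.symm⟩
  obtain ⟨v, hv, hcv⟩ := htb ⟨hc, fun h => hb.2 h.symm⟩
  have hst : Conn R J X s t :=
    (hu.trans (hcon u (hu.mem hs) v (hv.mem ht) hcu hcv)).trans hv.symm
  refine h.2.1 s hs fun d hd => ?_
  by_cases hda : d = a
  · exact hst.nbhd_subset (htb ⟨hd, fun h => hab (hda.symm.trans h)⟩)
  · exact hsa ⟨hd, hda⟩

lemma IsCore.disjoint [Finite V] (h : IsCore R J C X) : Disjoint C X := by
  refine Set.disjoint_left.2 fun c hc hcX => ?_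
  obtain ⟨u, hu, v, hv, hcu, hcv, hn⟩ := h.exists_not_conn hc
  exact hn (conn_of_mem_nbhd hu hv hcX (subset_nbhd hcu) (subset_nbhd hcv))

/-- Two elements of a core are separated by a member of the family. -/
lemma IsCore.eq_of_forall_mem (h : IsCore R J C X) {c d : V} (hc : c ∈ C) (hd : d ∈ C)
    (hcd : ∀ s ∈ J, c ∈ R s → d ∈ R s) : c = d := by
  by_contra hne
  obtain ⟨s, hs, hsub⟩ := h.2.2 d hd
  obtain ⟨t, ht, hct⟩ := hsub ⟨hc, hne⟩
  refine h.2.1 s hs fun a ha => ?_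
  by_cases hda : a = d
  · exact ⟨t, ht, hda ▸ hcd t (ht.mem hs) hct⟩
  · exact hsub ⟨ha, hda⟩

/-- If all of `J` outside `K` meets the union of the members in `K` within the single member
`R a`, then a core for `K` gives one for `J`. -/
lemma IsCore.of_subset [Finite V] {K : Finset I} (hKJ : K ⊆ J) {a : I} (ha : a ∈ K)
    (hret : ∀ t ∈ J, t ∉ K → ∀ k ∈ K, R t ∩ R k ⊆ R a) (h : IsCore R K C X) :
    IsCore R J C {x ∈ X | ∃ k ∈ K, x ∈ R k} := by
  classical
  set U : Set V := {x | ∃ k ∈ K, x ∈ R k} with hU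
  -- the retraction of `J` onto `K`
  let f : I → I := fun t => if t ∈ K then t else a
  have hfK : ∀ t, f t ∈ K := fun t => by
    by_cases ht : t ∈ K <;> simp [f, ht, ha]
  have hfR : ∀ t ∈ J, R t ∩ U ⊆ R (f t) := by
    rintro t ht x ⟨hxt, k, hk, hxk⟩
    by_cases htK : t ∈ K
    · simpa [f, htK] using hxt
    · simpa [f, htK] using hret t ht htK k hk ⟨hxt, hxk⟩
  have hconn : ∀ s t, Conn R J {x ∈ X | ∃ k ∈ K, x ∈ R k} s t → Conn R K X (f s) (f t) := by
    intro s t hst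
    refine ReflTransGen.lift f (fun s t hl => ?_) _ _ hst
    obtain ⟨hs, ht, x, hx, hxs, hxt⟩ := hl
    exact ⟨hfK s, hfK t, x, hx.1, hfR s hs ⟨hxs, hx.2⟩, hfR t ht ⟨hxt, hx.2⟩⟩
  have hCU : C ⊆ U := by
    intro c hc
    obtain ⟨u, hu, -, -, hcu, -⟩ := h.exists_not_conn hc
    exact ⟨u, hu, hcu⟩
  refine ⟨h.1, fun s hs hsub => ?_, fun c hc => ?_⟩
  · refine h.2.1 (f s) (hfK s) fun c hc => ?_
    obtain ⟨t, ht, hct⟩ := hsub hc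
    exact ⟨f t, hconn s t ht, hfR t (ht.mem hs) ⟨hct, hCU hc⟩⟩
  · obtain ⟨s, hs, hsub⟩ := h.2.2 c hc
    refine ⟨s, hKJ hs, fun d hd => ?_⟩
    obtain ⟨t, ht, hdt⟩ := hsub hd
    refine ⟨t, ReflTransGen.mono (fun u v hl => ?_) _ _ ht, hdt⟩
    obtain ⟨hu, hv, x, hx, hxu, hxv⟩ := hl
    exact ⟨hKJ hu, hKJ hv, x, ⟨hx, u, hu, hxu⟩, hxu, hxv⟩

/-- If there are at least two classes with respect to `X`, and every class covers `C`, then the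
class of `s` has a member that covers `C`, unless there is a core. -/
lemma exists_conn_subset [Finite V] (hno : ∀ C X, ¬ IsCore R J C X) (hXC : Disjoint X C)
    (hfull : ∀ s ∈ J, C ⊆ nbhd R J X s) (hs : s ∈ J) {z : I} (hz : z ∈ J)
    (hsz : ¬ Conn R J X s z) : ∃ a, Conn R J X s a ∧ C ⊆ R a := by
  classical
  by_contra! hcon
  -- the part of `X` outside the class of `s`
  let X₀ : Set V := {x ∈ X | x ∉ nbhd R J X s}
  let P : Set (Set V) := {Y | X₀ ⊆ Y ∧ Y ⊆ X ∧ ∀ t, Conn R J X s t → ¬ C ⊆ nbhd R J Y t}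
  have hX₀ : X₀ ∈ P := by
    refine ⟨subset_rfl, fun x hx => hx.1, fun t ht hsub => hcon t ht fun c hc => ?_⟩
    obtain ⟨u, hu, hcu⟩ := hsub hc
    rcases ReflTransGen.cases_head hu with rfl | ⟨w, ⟨-, -, x, hx, hxt, -⟩, -⟩
    · exact hcu
    · exact absurd ⟨t, ht, hxt⟩ hx.2
  obtain ⟨Y, hY⟩ := (Set.toFinite P).exists_maximal ⟨X₀, hX₀⟩
  obtain ⟨hX₀Y, hYX, hYs⟩ := hY.prop
  have hne : ¬ X ⊆ Y := by
    intro h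
    have : Y = X := hYX.antisymm h
    subst this
    exact hYs s .refl (hfull s hs)
  obtain ⟨x, hxX, hxY⟩ := Set.not_subset.1 hne
  have hxs : x ∈ nbhd R J X s := by
    by_contra h
    exact hxY (hX₀Y ⟨hxX, h⟩)
  have : ∃ t, Conn R J X s t ∧ C ⊆ nbhd R J (insert x Y) t := by
    by_contra! h
    exact hxY (hY.le_of_ge ⟨hX₀Y.trans (Set.subset_insert _ _),
      Set.insert_subset hxX hYX, h⟩ (Set.subset_insert _ _) (Set.mem_insert _ _))
  obtain ⟨t, hst, htC⟩ := this
  have htJ := hst.mem hs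
  obtain ⟨hxt, hcov⟩ := mem_nbhd_of_subset_nbhd_insert (hYs t hst) htC htJ
  have hclass : ∀ d ∈ J, x ∈ nbhd R J Y d → Conn R J X s d := fun d hd hxd =>
    conn_of_mem_nbhd hs hd hxX hxs (nbhd_mono hYX hxd)
  have hzY : ∀ w, Conn R J X z w → Conn R J Y z w := by
    intro w hw
    induction hw with
    | refl => exact .refl
    | @tail u w hzu hl ih =>
      have hzu : Conn R J X z u := hzu
      obtain ⟨hu, hw, y, hy, hyu, hyw⟩ := hl
      refine ih.tail ⟨hu, hw, y, hX₀Y ⟨hy, fun hys => ?_⟩, hyu, hyw⟩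
      exact hsz ((conn_of_mem_nbhd hs hu hy hys (subset_nbhd hyu)).trans hzu.symm)
  obtain ⟨C', -, hcore⟩ := exists_isCore_insert (hXC.notMem_of_mem_left hxX) htJ hxt
    (fun d hd hxd => hYs d (hclass d hd hxd)) hcov
    ⟨z, hz, fun hxz => hsz (hclass z hz hxz), fun c hc => by
      obtain ⟨w, hw, hcw⟩ := hfull z hz hc
      exact ⟨w, hzY w hw, hcw⟩⟩
  exact hno _ _ hcore

/-- `EarOrder R J r`: the members of `J` can be removed one by one, down to `r`, such that each one
is an ear when it is removed: its intersections with the remaining members are contained in one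
of these. -/
inductive EarOrder [DecidableEq I] (R : I → Set V) : Finset I → I → Prop
  | single (r : I) : EarOrder R {r} r
  | insert {J : Finset I} {r : I} (s s' : I) (hs : s ∉ J) (hs' : s' ∈ J)
      (hear : ∀ t ∈ J, R s ∩ R t ⊆ R s') (h : EarOrder R J r) : EarOrder R (insert s J) r

/-- Ear orders of two families can be concatenated if the intersections between the families are
contained in a member of each: the last member `b` of `L` is then an ear because of `a`. -/
lemma EarOrder.union [DecidableEq I] {K L : Finset I} {r a b : I} (hK : EarOrder R K r)
    (hL : EarOrder R L b) (hKL : Disjoint K L) (ha : a ∈ K)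
    (hsep : ∀ s ∈ K, ∀ t ∈ L, R s ∩ R t ⊆ R a ∩ R b) : EarOrder R (K ∪ L) r := by
  induction hL with
  | single b =>
    rw [Finset.union_comm]
    refine EarOrder.insert b a (Finset.disjoint_singleton_right.1 hKL) ha (fun t ht => ?_) hK
    rw [Set.inter_comm]
    exact (hsep t ht b (Finset.mem_singleton_self b)).trans Set.inter_subset_left
  | @insert L b s s' hs hs' hear h ih =>
    rw [Finset.union_insert]
    have hbL : b ∈ L := by
      clear ih hear hs' hs hsep hKL
      induction h with
      | single r => exact Finset.mem_singleton_self r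
      | insert _ _ _ _ _ _ ih => exact Finset.mem_insert_of_mem ih
    rw [Finset.disjoint_insert_right] at hKL
    refine EarOrder.insert s s' ?_ (Finset.mem_union_right _ hs') (fun t ht => ?_)
      (ih hKL.2 fun t ht u hu => hsep t ht u (Finset.mem_insert_of_mem hu))
    · simp [hKL.1, hs]
    · rcases Finset.mem_union.1 ht with ht | ht
      · intro x hx
        exact hear b hbL ⟨hx.1, (hsep t ht s (Finset.mem_insert_self _ _) hx.symm).2⟩
      · exact hear t ht

/-- A family without a core can be removed ear by ear, down to any of its members. -/
lemma earOrder_of_forall_not_isCore [Finite V] [DecidableEq I] (J : Finset I)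
    (hno : ∀ C X, ¬ IsCore R J C X) {r : I} (hr : r ∈ J) : EarOrder R J r := by
  classical
  induction hn : J.card using Nat.strong_induction_on generalizing J r with
  | _ n ih =>
  subst hn
  by_cases hJ : ∀ t ∈ J, t = r
  · obtain rfl : J = {r} := Finset.eq_singleton_iff_unique_mem.2 ⟨hr, hJ⟩
    exact .single r
  push Not at hJ
  obtain ⟨q, hqJ, hqr⟩ := hJ
  let P : Set (Set V) := {X | ∃ s ∈ J, ∃ t ∈ J, ¬ Conn R J X s t}
  have hP : P.Nonempty := by
    refine ⟨∅, q, hqJ, r, hr, fun h => ?_⟩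
    rcases ReflTransGen.cases_head h with h | ⟨w, ⟨-, -, x, hx, -⟩, -⟩
    exacts [hqr h, hx]
  obtain ⟨X, hX⟩ := (Set.toFinite P).exists_maximal hP
  -- by maximality, every element outside `X` is in the union of every class
  have hfull : ∀ s ∈ J, Xᶜ ⊆ nbhd R J X s := by
    intro s hs v hv
    by_contra hvs
    have hv' : insert v X ∉ P := fun h =>
      hv (hX.le_of_ge h (Set.subset_insert _ _) (Set.mem_insert _ _))
    obtain ⟨a, ha, b, hb, hab⟩ := hX.prop
    have key : ∀ t ∈ J, Conn R J X s t := by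
      intro t ht
      have : Conn R J (insert v X) s t := by
        by_contra h
        exact hv' ⟨s, hs, t, ht, h⟩
      rcases this.of_insert with h | h
      exacts [h, absurd h.1 hvs]
    exact hab ((key a ha).symm.trans (key b hb))
  obtain ⟨q', hq', hrq'⟩ : ∃ t ∈ J, ¬ Conn R J X r t := by
    by_contra! h
    obtain ⟨a, ha, b, hb, hab⟩ := hX.prop
    exact hab ((h a ha).symm.trans (h b hb))
  obtain ⟨a, hra, haC⟩ := exists_conn_subset hno disjoint_compl_right hfull hr hq' hrq'
  obtain ⟨b, hqb, hbC⟩ := exists_conn_subset hno disjoint_compl_right hfull hq' hr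
    (fun h => hrq' h.symm)
  let K := J.filter fun t => Conn R J X r t
  let L := J.filter fun t => ¬ Conn R J X r t
  have haK : a ∈ K := Finset.mem_filter.2 ⟨hra.mem hr, hra⟩
  have hbL : b ∈ L := Finset.mem_filter.2 ⟨hqb.mem hq', fun h => hrq' (h.trans hqb.symm)⟩
  have hsep : ∀ s ∈ K, ∀ t ∈ L, R s ∩ R t ⊆ R a ∩ R b := by
    intro s hs t ht v hv
    have hvX : v ∈ Xᶜ := by
      intro hvX
      obtain ⟨hsJ, hs⟩ := Finset.mem_filter.1 hs
      obtain ⟨htJ, ht⟩ := Finset.mem_filter.1 ht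
      exact ht (hs.tail ⟨hsJ, htJ, v, hvX, hv.1, hv.2⟩)
    exact ⟨haC hvX, hbC hvX⟩
  have hKJ : K ⊆ J := Finset.filter_subset _ _
  have hLJ : L ⊆ J := Finset.filter_subset _ _
  have hdisj : Disjoint K L := Finset.disjoint_filter_filter_not _ _ _
  have hunion : K ∪ L = J := Finset.filter_union_filter_not_eq _ _
  have hKlt : K.card < J.card := Finset.card_lt_card
    ⟨hKJ, fun h => Finset.disjoint_left.1 hdisj (h (hLJ hbL)) hbL⟩
  have hLlt : L.card < J.card := Finset.card_lt_card
    ⟨hLJ, fun h => Finset.disjoint_left.1 hdisj haK (h (hKJ haK))⟩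
  have hK : EarOrder R K r := by
    refine ih _ hKlt K (fun C' X' h => ?_) (Finset.mem_filter.2 ⟨hr, .refl⟩) rfl
    refine hno _ _ (h.of_subset hKJ haK fun t ht htK k hk => ?_)
    have htL : t ∈ L := by
      rw [← hunion] at ht
      exact (Finset.mem_union.1 ht).resolve_left htK
    rw [Set.inter_comm]
    exact (hsep k hk t htL).trans Set.inter_subset_left
  have hL : EarOrder R L b := by
    refine ih _ hLlt L (fun C' X' h => ?_) hbL rfl
    refine hno _ _ (h.of_subset hLJ hbL fun t ht htL k hk => ?_)
    have htK : t ∈ K := by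
      rw [← hunion] at ht
      exact (Finset.mem_union.1 ht).resolve_right htL
    exact (hsep t htK k hk).trans Set.inter_subset_right
  rw [← hunion]
  exact hK.union hL hdisj haK hsep

end SetFamily

/-! ### Ear orders give DAG-tree decompositions of width one -/

namespace SetFamily

open Relation

variable {I V : Type*} {R : I → Set V} {J : Finset I}

/-- Joining every ear to the member that contains its intersections gives a tree on `J` in which,
for each `v`, the members that contain `v` are connected. -/
lemma EarOrder.exists_isAcyclic [DecidableEq I] {r : I} (h : EarOrder R J r) :
    ∃ G : SimpleGraph I, G.IsAcyclic ∧ (∀ s t, G.Adj s t → s ∈ J ∧ t ∈ J) ∧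
      ∀ W : Set I, (W = Set.univ ∨ ∃ v, W = {s | v ∈ R s}) → ∀ s ∈ J, ∀ t ∈ J, s ∈ W → t ∈ W →
        ReflTransGen (fun a b => G.Adj a b ∧ a ∈ W ∧ b ∈ W) s t := by
  induction h with
  | single r =>
    refine ⟨⊥, SimpleGraph.isAcyclic_bot, fun s t h => h.elim, fun W _ s hs t ht _ _ => ?_⟩
    rw [Finset.mem_singleton.1 hs, Finset.mem_singleton.1 ht]
  | @insert J r s s' hs hs' hear h ih =>
    obtain ⟨G, hG, hGJ, hW⟩ := ih
    have hne : s ≠ s' := fun h => hs (h ▸ hs')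
    have hnr : ¬ G.Reachable s s' := by
      rintro ⟨p⟩
      cases p with
      | nil => exact hne rfl
      | cons hadj _ => exact hs (hGJ _ _ hadj).1
    refine ⟨G ⊔ SimpleGraph.edge s s', hG.sup_edge_of_not_reachable hnr, ?_, ?_⟩
    · intro a b hab
      rcases hab with hab | hab
      · exact ⟨Finset.mem_insert_of_mem (hGJ _ _ hab).1, Finset.mem_insert_of_mem (hGJ _ _ hab).2⟩
      · rw [SimpleGraph.edge_adj] at hab
        rcases hab.1 with ⟨rfl, rfl⟩ | ⟨rfl, rfl⟩ <;> simp [hs']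
    · intro W hWR
      have hold : ∀ a ∈ J, ∀ b ∈ J, a ∈ W → b ∈ W → ReflTransGen
          (fun a b => (G ⊔ SimpleGraph.edge s s').Adj a b ∧ a ∈ W ∧ b ∈ W) a b :=
        fun a ha b hb haW hbW => ReflTransGen.mono (fun a b hab => ⟨.inl hab.1, hab.2⟩) _ _
          (hW W hWR a ha b hb haW hbW)
      have hs'W : ∀ t ∈ J, s ∈ W → t ∈ W → s' ∈ W := by
        intro t ht hsW htW
        rcases hWR with rfl | ⟨v, rfl⟩
        · trivial
        · exact hear t ht ⟨hsW, htW⟩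
      have hadj : (G ⊔ SimpleGraph.edge s s').Adj s s' := by
        right
        rw [SimpleGraph.edge_adj]
        exact ⟨.inl ⟨rfl, rfl⟩, hne⟩
      intro a ha b hb haW hbW
      rcases Finset.mem_insert.1 ha with rfl | ha' <;>
        rcases Finset.mem_insert.1 hb with rfl | hb'
      · exact .refl
      · have h' := hs'W b hb' haW hbW
        exact .head ⟨hadj, haW, h'⟩ (hold _ hs' _ hb' h' hbW)
      · have h' := hs'W a ha' hbW haW
        exact .tail (hold _ ha' _ hs' haW h') ⟨hadj.symm, h', hbW⟩
      · exact hold a ha' b hb' haW hbW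

end SetFamily

namespace Digraph

open Relation SetFamily

variable {V : Type*} {D : Digraph V}

/-- An ear order of the reach sets of the sources gives a DAG-tree decomposition whose nodes are
the singletons of sources. -/
lemma exists_width_le_one_of_earOrder [DecidableEq V] {J : Finset V} {r : V}
    (hJ : ∀ s, s ∈ J ↔ s ∈ D.sources) (hr : r ∈ J) (h : EarOrder D.reach J r) :
    ∃ T : D.DagTreeDecomposition, T.width ≤ 1 := by
  obtain ⟨G, hG, hGJ, hW⟩ := h.exists_isAcyclic
  let bags : Finset (Finset V) := J.image fun s => {s}
  have hbags : ∀ B : bags, ∃ s ∈ J, B.1 = {s} := by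
    rintro ⟨B, hB⟩
    obtain ⟨s, hs, rfl⟩ := Finset.mem_image.1 hB
    exact ⟨s, hs, rfl⟩
  choose elt heltJ helt using hbags
  let node : ∀ s, s ∈ J → bags := fun s hs => ⟨{s}, Finset.mem_image_of_mem _ hs⟩
  have helt_node : ∀ s (hs : s ∈ J), elt (node s hs) = s := fun s hs =>
    (Finset.singleton_injective (helt (node s hs))).symm
  have hinj : Function.Injective elt := fun B B' hBB => Subtype.ext (by rw [helt, helt, hBB])
  have hreach : ∀ B : bags, D.reachSet B.1 = D.reach (elt B) := by
    intro B
    rw [reachSet, helt B]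
    simp
  let T : SimpleGraph bags := G.comap elt
  have hwalk : ∀ W : Set V, (W = Set.univ ∨ ∃ v, W = {s | v ∈ D.reach s}) → ∀ B B' : bags,
      elt B ∈ W → elt B' ∈ W → ∃ p : T.Walk B B', ∀ A ∈ p.support, elt A ∈ W := by
    intro W hWR B B' hB hB'
    have key : ∀ t, ReflTransGen (fun a b => G.Adj a b ∧ a ∈ W ∧ b ∈ W) (elt B) t →
        ∀ B' : bags, elt B' = t → ∃ p : T.Walk B B', ∀ A ∈ p.support, elt A ∈ W := by
      intro t ht
      induction ht with
      | refl =>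
        intro B' hBB
        obtain rfl := hinj hBB
        exact ⟨.nil, by simpa using hB⟩
      | @tail a b _ hab ih =>
        rintro B' rfl
        obtain ⟨haJ, -⟩ := hGJ _ _ hab.1
        obtain ⟨p, hp⟩ := ih (node a haJ) (helt_node a haJ)
        have hadj : T.Adj (node a haJ) B' := by
          change G.Adj (elt _) (elt _)
          rw [helt_node a haJ]
          exact hab.1
        refine ⟨p.concat hadj, fun A hA => ?_⟩
        rw [SimpleGraph.Walk.support_concat] at hA
        rcases List.mem_append.1 hA with hA | hA
        · exact hp A hA
        · rw [List.mem_singleton.1 hA]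
          exact hab.2.2
    exact key _ (hW W hWR _ (heltJ B) _ (heltJ B') hB hB') B' rfl
  have hTac : T.IsAcyclic := hG.of_comap ⟨elt, hinj⟩
  have hTconn : T.Connected := by
    have : Nonempty bags := ⟨node r hr⟩
    refine ⟨fun B B' => ?_⟩
    obtain ⟨p, -⟩ := hwalk Set.univ (.inl rfl) B B' trivial trivial
    exact ⟨p⟩
  refine ⟨⟨bags, T, node r hr, ⟨hTconn, hTac⟩, ?_, ?_, ?_⟩, ?_⟩
  · intro B s hs
    rw [helt B, Finset.mem_singleton] at hs
    rw [hs]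
    exact (hJ _).1 (heltJ B)
  · intro s hs
    exact ⟨node s ((hJ s).2 hs), Finset.mem_singleton_self s⟩
  · rintro B B₁ B₂ p hp hB v ⟨h1, h2⟩
    rw [hreach] at h1 h2 ⊢
    obtain ⟨q, hq⟩ := hwalk {s | v ∈ D.reach s} (.inr ⟨v, rfl⟩) B₁ B₂ h1 h2
    have hpq : p = q.bypass := congrArg Subtype.val
      ((hTac.subsingleton_path _ _).elim ⟨p, hp⟩ ⟨q.bypass, q.bypass_isPath⟩)
    rw [hpq] at hB
    exact hq B (q.support_bypass_subset_support hB)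
  · refine Finset.sup_le fun B hB => ?_
    have := helt ⟨B, hB⟩
    simp only at this
    rw [this, Finset.card_singleton]

end Digraph

/-! ### Cores of reach sets in directed acyclic graphs -/

namespace Digraph

open Relation SetFamily

variable {V : Type*} {D : Digraph V} {n : ℕ} {π : V → Fin n}

lemma eq_or_lt_of_mem_reach (hπ : ∀ u v, D.Adj u v → π u < π v) {u v : V} (h : v ∈ D.reach u) :
    u = v ∨ π u < π v := by
  induction h with
  | refl => exact .inl rfl
  | tail _ h ih =>
    right
    rcases ih with rfl | ih
    exacts [hπ _ _ h, ih.trans (hπ _ _ h)]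

lemma exists_mem_sources (hπ : ∀ u v, D.Adj u v → π u < π v) (v : V) :
    ∃ s ∈ D.sources, v ∈ D.reach s := by
  induction hm : π v using WellFoundedLT.induction generalizing v with
  | ind m ih =>
  subst hm
  by_cases h : v ∈ D.sources
  · exact ⟨v, h, .refl⟩
  · simp only [sources, Set.mem_ofPred_eq, not_forall, not_not] at h
    obtain ⟨u, hu⟩ := h
    obtain ⟨s, hs, hsu⟩ := ih _ (hπ _ _ hu) u rfl
    exact ⟨s, hs, hsu.tail hu⟩

lemma mem_of_mem_reach {X : Set V} (hX : ∀ u v, D.Adj u v → v ∈ X → u ∈ X) {u v : V}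
    (h : v ∈ D.reach u) (hv : v ∈ X) : u ∈ X := by
  induction h with
  | refl => exact hv
  | tail _ h ih => exact ih (hX _ _ h hv)

/-- Any core for the reach sets of the sources can be moved towards the sources until all the
predecessors of its elements lie in the linking set, which is closed under predecessors. If a
predecessor `x` of `c ∈ C` is missing, then adding it to `X` leaves a core, or `x` can replace `c`
and some other elements of `C`; in both cases fewer ancestors of the core lie outside of `X`. -/
lemma exists_isCore_closed [Finite V] (hπ : ∀ u v, D.Adj u v → π u < π v) {J : Finset V}
    {C X : Set V} (hcore : IsCore D.reach J C X) :
    ∃ C X, IsCore D.reach J C X ∧ ∀ u v, D.Adj u v → v ∈ X ∪ C → u ∈ X := by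
  -- adding the ancestors of a set to it does not change the classes
  have hconn : ∀ (X : Set V) (Y : Set V), (∀ y ∈ Y, ∃ x ∈ X, x ∈ D.reach y) → ∀ s,
      nbhd D.reach J Y s ⊆ nbhd D.reach J X s := by
    rintro X Y hXY s v ⟨t, ht, hv⟩
    refine ⟨t, ReflTransGen.mono (fun a b hl => ?_) _ _ ht, hv⟩
    obtain ⟨ha, hb, y, hy, hya, hyb⟩ := hl
    obtain ⟨x, hx, hxy⟩ := hXY y hy
    exact ⟨ha, hb, x, hx, hya.trans hxy, hyb.trans hxy⟩
  have hmain : ∀ m : ℕ, ∀ C X : Set V, (∀ u v, D.Adj u v → v ∈ X → u ∈ X) →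
      IsCore D.reach J C X → ({v | ∃ c ∈ C, c ∈ D.reach v} \ X).ncard = m →
      ∃ C X, IsCore D.reach J C X ∧ ∀ u v, D.Adj u v → v ∈ X ∪ C → u ∈ X := by
    intro m
    induction m using Nat.strong_induction_on with
    | _ m ih =>
    intro C X hX hcore hm
    by_cases hC : ∀ u v, D.Adj u v → v ∈ C → u ∈ X
    · exact ⟨C, X, hcore, fun u v huv hv => hv.elim (hX u v huv) (hC u v huv)⟩
    push Not at hC
    obtain ⟨x, c₀, hxc, hc₀, hxX⟩ := hC
    have hanti : ∀ a ∈ C, ∀ b ∈ C, b ∈ D.reach a → a = b := fun a ha b hb hab =>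
      hcore.eq_of_forall_mem ha hb fun s _ hs => hs.trans hab
    have hxC : x ∉ C := fun h => by
      have := hanti x h c₀ hc₀ (.single hxc)
      exact (hπ _ _ hxc).ne (congrArg π this)
    have hup : ∀ d, x ∈ nbhd D.reach J X d → c₀ ∈ nbhd D.reach J X d := fun d ⟨t, ht, hxt⟩ =>
      ⟨t, ht, hxt.tail hxc⟩
    have hins : ∀ d, c₀ ∈ nbhd D.reach J X d → C \ {c₀} ⊆ nbhd D.reach J X d →
        C ⊆ nbhd D.reach J X d := by
      intro d h1 h2 a ha
      by_cases hac : a = c₀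
      · rwa [hac]
      · exact h2 ⟨ha, hac⟩
    by_cases hcore' : IsCore D.reach J C (X ∪ {v | x ∈ D.reach v})
    · refine ih _ ?_ C _ ?_ hcore' rfl
      · rw [← hm]
        refine Set.ncard_lt_ncard ⟨Set.sdiff_subset_sdiff_right Set.subset_union_left, fun h => ?_⟩
          (Set.toFinite _)
        exact (h (a := x) ⟨⟨c₀, hc₀, .single hxc⟩, hxX⟩).2 (.inr .refl)
      · rintro u v huv (hv | hv)
        · exact .inl (hX u v huv hv)
        · exact .inr (ReflTransGen.head huv hv)
    · obtain ⟨s, hs, hsC⟩ :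
          ∃ s ∈ J, C ⊆ nbhd D.reach J (X ∪ {v | x ∈ D.reach v}) s := by
        by_contra! h
        exact hcore' ⟨hcore.1, h, fun c hc =>
          (hcore.2.2 c hc).imp fun s hs => ⟨hs.1, hs.2.trans (nbhd_mono Set.subset_union_left)⟩⟩
      have hsC' : C ⊆ nbhd D.reach J (insert x X) s := by
        refine hsC.trans (hconn _ _ ?_ s)
        rintro y (hy | hy)
        · exact ⟨y, .inr hy, .refl⟩
        · exact ⟨x, .inl rfl, hy⟩
      obtain ⟨hxs, hcov⟩ := mem_nbhd_of_subset_nbhd_insert (hcore.2.1 s hs) hsC' hs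
      obtain ⟨z, hz, hzC⟩ := hcore.2.2 c₀ hc₀
      obtain ⟨C', hC', hcore''⟩ := exists_isCore_insert (C := C \ {c₀}) (fun h => hxC h.1) hs hxs
        (fun d hd hxd h => hcore.2.1 d hd (hins d (hup d hxd) h)) (fun c hc => hcov c hc.1)
        ⟨z, hz, fun h => hcore.2.1 z hz (hins z (hup z h) hzC), hzC⟩
      refine ih _ ?_ _ X hX hcore'' rfl
      rw [← hm]
      refine Set.ncard_lt_ncard ⟨?_, fun h => ?_⟩ (Set.toFinite _)
      · rintro v ⟨⟨c, rfl | hc, hvc⟩, hvX⟩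
        · exact ⟨⟨c₀, hc₀, hvc.tail hxc⟩, hvX⟩
        · exact ⟨⟨c, (hC' hc).1, hvc⟩, hvX⟩
      · obtain ⟨⟨c, hc, hcc⟩, -⟩ := h (a := c₀)
          ⟨⟨c₀, hc₀, .refl⟩, Set.disjoint_left.1 hcore.disjoint hc₀⟩
        rcases hc with rfl | hc
        · have := hπ _ _ hxc
          rcases eq_or_lt_of_mem_reach hπ hcc with h | h
          · exact this.ne (congrArg π h.symm)
          · exact this.not_gt h
        · exact (hC' hc).2 (hanti c₀ hc₀ c (hC' hc).1 hcc).symm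
  have hle : ∀ s, nbhd D.reach J X s ⊆ nbhd D.reach J {v | ∃ x ∈ X, x ∈ D.reach v} s := fun s =>
    nbhd_mono fun x hx => ⟨x, hx, .refl⟩
  refine hmain _ C {v | ∃ x ∈ X, x ∈ D.reach v} ?_ ⟨hcore.1, fun s hs h => ?_, fun c hc => ?_⟩ rfl
  · rintro u v huv ⟨x, hx, hvx⟩
    exact ⟨x, hx, ReflTransGen.head huv hvx⟩
  · exact hcore.2.1 s hs (h.trans (hconn X _ (fun y hy => hy) s))
  · exact (hcore.2.2 c hc).imp fun s hs => ⟨hs.1, hs.2.trans (hle s)⟩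

end Digraph

/-! ### Cores give obstructions -/

namespace Hypergraph

open Relation SetFamily Digraph

variable {α : Type*} {H : Hypergraph α} {l : ℕ∞} {S T C D : Set α}

lemma trimmed_trimmed_adj (hTS : T ⊆ S) {x y : α} :
    ((H.trimmed ⊤ S).trimmed ⊤ T).Adj x y ↔ ∃ e ∈ E(H), x ∈ e ∧ x ∈ T ∧ y ∈ e ∧ y ∈ T := by
  constructor
  · rintro ⟨_, ⟨_, ⟨e, he, -, -, rfl⟩, -, -, rfl⟩, hx, hy⟩
    exact ⟨e, he, hx.1.1, hx.2, hy.1.1, hy.2⟩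
  · rintro ⟨e, he, hxe, hx, hye, hy⟩
    exact ⟨e ∩ S ∩ T, ⟨e ∩ S, ⟨e, he, le_top, ⟨x, hxe, hTS hx⟩, rfl⟩, le_top,
      ⟨x, ⟨hxe, hTS hx⟩, hx⟩, rfl⟩, ⟨⟨hxe, hTS hx⟩, hx⟩, ⟨⟨hye, hTS hy⟩, hy⟩⟩

lemma mem_connectorEdges_trimmed {f : Set α} : f ∈ (H.trimmed ⊤ S).connectorEdges C D ↔
    ∃ e ∈ E(H), f = e ∩ S ∧ e ∩ S ⊆ C ∪ D ∧ 1 < (e ∩ S).encard := by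
  constructor
  · rintro ⟨⟨e, he, -, -, rfl⟩, h1, h2⟩
    exact ⟨e, he, rfl, h1, h2⟩
  · rintro ⟨e, he, rfl, h1, h2⟩
    exact ⟨⟨e, he, le_top, Set.encard_ne_zero.1 (zero_lt_one.trans h2).ne', rfl⟩, h1, h2⟩

lemma conn_adj_symm {x y : α} (h : ReflTransGen H.Adj x y) : ReflTransGen H.Adj y x := by
  have : Std.Symm H.Adj := ⟨fun _ _ h => h.symm⟩
  exact ReflTransGen.stdSymm.symm _ _ h

variable {π : H.Orientation}

lemma lt_of_skeleton_adj (u v : V(H)) (h : (H.skeleton π l).Adj u v) : π u < π v := by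
  obtain ⟨e, -, -, -, h, -⟩ := h
  exact h

/-- The first vertex of a hyperedge has an edge of the skeleton to all the others. -/
lemma exists_first {e : Set α} (he : e ∈ E(H)) {a : α} (ha : a ∈ e) :
    ∃ f : V(H), f.1 ∈ e ∧ ∀ w : V(H), w.1 ∈ e → w = f ∨ (H.skeleton π l).Adj f w := by
  obtain ⟨f, hf, hmin⟩ := WellFounded.has_min (InvImage.wf π wellFounded_lt)
    {w : V(H) | w.1 ∈ e} ⟨⟨a, he.subset_vertexSet ha⟩, ha⟩
  refine ⟨f, hf, fun w hw => ?_⟩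
  rcases lt_trichotomy (π w) (π f) with h | h | h
  · exact absurd h (hmin w hw)
  · exact .inl (π.injective h)
  · refine .inr ⟨e, he, hf, hw, h, ?_⟩
    have : {w : V(H) | w.1 ∈ e ∧ π w < π f} = ∅ :=
      Set.eq_empty_of_forall_notMem fun w hw => hmin w hw.1 hw.2
    rw [this]
    simp

/-- A core of the reach sets whose linking set contains all the predecessors of the core and is
closed under predecessors induces an obstruction. -/
lemma trimmed_mem_obstructions {J : Finset V(H)} (hfin : Finite V(H))
    (hJ : ∀ s, s ∈ J ↔ s ∈ (H.skeleton π l).sources)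
    {C X : Set V(H)} (hcore : IsCore (H.skeleton π l).reach J C X)
    (hcl : ∀ u v, (H.skeleton π l).Adj u v → v ∈ X ∪ C → u ∈ X) :
    H.trimmed ⊤ (Subtype.val '' (X ∪ C)) ∈ obstructions α l := by
  set G := H.skeleton π l
  have hπ : ∀ u v, G.Adj u v → π u < π v := lt_of_skeleton_adj
  have hdisj : ∀ c ∈ C, c ∉ X := fun c hc => Set.disjoint_left.1 hcore.disjoint hc
  have hval : ∀ (A : Set V(H)) (u : V(H)), u.1 ∈ Subtype.val '' A ↔ u ∈ A := fun A u =>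
    Subtype.val_injective.mem_set_image
  have hSC : Subtype.val '' (X ∪ C) \ Subtype.val '' C = Subtype.val '' X := by
    rw [← Set.image_sdiff Subtype.val_injective, Set.union_sdiff_right,
      hcore.disjoint.symm.sdiff_eq_left]
  have hXS : Subtype.val '' X ⊆ Subtype.val '' (X ∪ C) := Set.image_mono Set.subset_union_left
  set A := ((H.trimmed ⊤ (Subtype.val '' (X ∪ C))).trimmed ⊤ (Subtype.val '' X)).Adj
  have hAdj : ∀ x y : α, A x y ↔
      ∃ e ∈ E(H), x ∈ e ∧ x ∈ Subtype.val '' X ∧ y ∈ e ∧ y ∈ Subtype.val '' X := fun x y =>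
    trimmed_trimmed_adj hXS
  have hAsymm : ∀ {x y : α}, ReflTransGen A x y → ReflTransGen A y x := conn_adj_symm
  have hXcl : ∀ u v, G.Adj u v → v ∈ X → u ∈ X := fun u v huv hv => hcl u v huv (.inl hv)
  -- the vertices of a component are all reached from one class of sources
  have hcomp : ∀ v ∈ X, ∀ s ∈ J, v ∈ G.reach s → ∀ w, ReflTransGen A v.1 w →
      ∃ w' ∈ X, w'.1 = w ∧ w' ∈ nbhd G.reach J X s := by
    intro v hv s hs hsv w hw
    induction hw with
    | refl => exact ⟨v, hv, rfl, subset_nbhd hsv⟩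
    | tail _ h ih =>
      obtain ⟨x, hx, rfl, hxs⟩ := ih
      obtain ⟨e, he, hxe, -, hye, ⟨y, hy, rfl⟩⟩ := (hAdj _ _).1 h
      obtain ⟨f, hfe, hf⟩ := exists_first (π := π) (l := l) he hxe
      obtain ⟨t, ht, htf⟩ := exists_mem_sources hπ f
      have hft : ∀ w : V(H), w.1 ∈ e → w ∈ G.reach t := fun w hw => by
        rcases hf w hw with rfl | hfw
        exacts [htf, htf.tail hfw]
      have hst : Conn G.reach J X s t :=
        conn_of_mem_nbhd hs ((hJ t).2 ht) hx hxs (subset_nbhd (hft x hxe))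
      exact ⟨y, hy, rfl, t, hst, hft y hye⟩
  -- a core vertex that is attached to a component is reached from this class
  have hconn_nbhd : ∀ v ∈ X, ∀ s ∈ J, v ∈ G.reach s → ∀ c ∈ C,
      c.1 ∈ ⋃₀ (H.trimmed ⊤ (Subtype.val '' (X ∪ C))).connectorEdges (Subtype.val '' C)
        {w ∈ Subtype.val '' X | ReflTransGen A v.1 w} → c ∈ nbhd G.reach J X s := by
    rintro v hv s hs hsv c hc ⟨_, hfe, hce⟩
    obtain ⟨e, he, rfl, hsub, hcard⟩ := mem_connectorEdges_trimmed.1 hfe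
    obtain ⟨f, hfe, hf⟩ := exists_first (π := π) (l := l) he hce.1
    have hfX : f ∈ X := by
      rcases hf c hce.1 with rfl | hfc
      · exfalso
        obtain ⟨a, b, ha, hb, hab⟩ := Set.one_lt_encard_iff.1 hcard
        have : ∃ y : V(H), y.1 ∈ e ∧ y ∈ X ∪ C ∧ y ≠ c := by
          by_cases hac : a = c.1
          · obtain ⟨b', hb', rfl⟩ := hb.2
            exact ⟨b', hb.1, hb', fun h => hab (hac.trans (congrArg _ h.symm))⟩
          · obtain ⟨a', ha', rfl⟩ := ha.2
            exact ⟨a', ha.1, ha', fun h => hac (congrArg _ h)⟩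
        obtain ⟨y, hye, hy, hyc⟩ := this
        exact hdisj c hc (hcl c y ((hf y hye).resolve_left hyc) hy)
      · exact hcl f c hfc (.inr hc)
    have hfc : G.Adj f c := (hf c hce.1).resolve_left fun h => hdisj c hc (h ▸ hfX)
    rcases hsub ⟨hfe, (hval _ _).2 (.inl hfX)⟩ with h | h
    · exact absurd hfX (hdisj f ((hval _ _).1 h))
    · obtain ⟨f', -, hff, t, ht, htf⟩ := hcomp v hv s hs hsv _ h.2
      obtain rfl := Subtype.val_injective hff
      exact ⟨t, ht, htf.tail hfc⟩
  have hpath : ∀ u w, w ∈ G.reach u → w ∈ X → ReflTransGen A u.1 w.1 := by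
    intro u w h
    induction h with
    | refl => exact fun _ => .refl
    | @tail b c _ hbc ih =>
      intro hc
      have hb := hXcl b c hbc hc
      obtain ⟨e, he, hbe, hce, -⟩ := hbc
      exact (ih hb).tail ((hAdj _ _).2 ⟨e, he, hbe, (hval _ _).2 hb, hce, (hval _ _).2 hc⟩)
  have hconn_path : ∀ t u, Conn G.reach J X t u → ReflTransGen A t.1 u.1 := by
    intro t u h
    induction h with
    | refl => exact .refl
    | tail _ h ih =>
      obtain ⟨-, -, x, hx, hxb, hxc⟩ := h
      exact (ih.trans (hpath _ _ hxb hx)).trans (hAsymm (hpath _ _ hxc hx))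
  -- the last vertex before a core vertex on a directed path is in the linking set
  have hlast : ∀ c ∈ C, ∀ t ∈ J, c ∈ G.reach t → ∃ y ∈ X, y ∈ G.reach t ∧ G.Adj y c := by
    intro c hc t ht htc
    rcases ReflTransGen.cases_tail htc with h | ⟨y, hty, hyc⟩
    · exfalso
      obtain ⟨u, hu, v, hv, hcu, hcv, hn⟩ := hcore.exists_not_conn hc
      have hsrc : ∀ u, c ∈ G.reach u → u = c := by
        intro u hu
        rcases ReflTransGen.cases_tail hu with h' | ⟨y, -, hyc⟩
        · exact h'.symm
        · exact absurd hyc ((hJ c).1 (h ▸ ht) y)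
      rw [hsrc u hcu, hsrc v hcv] at hn
      exact hn .refl
    · exact ⟨y, hcl y c hyc (.inr hc), hty, hyc⟩
  -- conversely to `hconn_nbhd`, all that a class reaches in `C` is attached to its component
  have hnbhd_conn : ∀ t ∈ J, ∀ c ∈ C, c ∈ nbhd G.reach J X t →
      c.1 ∈ ⋃₀ (H.trimmed ⊤ (Subtype.val '' (X ∪ C))).connectorEdges (Subtype.val '' C)
        {w ∈ Subtype.val '' X | ReflTransGen A t.1 w} := by
    rintro t ht c hc ⟨u, htu, huc⟩
    obtain ⟨y, hy, huy, hyc⟩ := hlast c hc u (htu.mem ht) huc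
    have hty : ReflTransGen A t.1 y.1 := (hconn_path t u htu).trans (hpath u y huy hy)
    obtain ⟨e, he, hye, hce, hlt, -⟩ := hyc
    refine ⟨e ∩ Subtype.val '' (X ∪ C), mem_connectorEdges_trimmed.2 ⟨e, he, rfl, ?_, ?_⟩,
      hce, (hval _ _).2 (.inr hc)⟩
    · rintro _ ⟨hze, z, hz | hz, rfl⟩
      · exact .inr ⟨(hval _ _).2 hz, hty.tail
          ((hAdj _ _).2 ⟨e, he, hye, (hval _ _).2 hy, hze, (hval _ _).2 hz⟩)⟩
      · exact .inl ((hval _ _).2 hz)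
    · refine Set.one_lt_encard_iff.2 ⟨y.1, c.1, ⟨hye, (hval _ _).2 (.inl hy)⟩,
        ⟨hce, (hval _ _).2 (.inr hc)⟩, fun h => ?_⟩
      exact hlt.ne (congrArg π (Subtype.val_injective h))
  refine ⟨C.ncard, Subtype.val '' C, hcore.1, Set.image_mono Set.subset_union_right, ?_, ?_, ?_, ?_⟩
  · rw [Subtype.val_injective.encard_image, (Set.toFinite C).cast_ncard_eq]
  · rintro _ ⟨_, ⟨e, he, -, -, rfl⟩, hle, -, rfl⟩
    rw [Set.encard_le_one_iff]
    by_contra! hcon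
    obtain ⟨_, _, ⟨⟨hue, -⟩, u, hu, rfl⟩, ⟨⟨hve, -⟩, v, hv, rfl⟩, huv⟩ := hcon
    have huv' : u ≠ v := fun h => huv (congrArg _ h)
    -- the first vertex of `e` outside of the linking set has at most `l` vertices before it
    obtain ⟨w, ⟨hwe, hwX⟩, hmin⟩ := WellFounded.has_min (InvImage.wf π wellFounded_lt)
      {w : V(H) | w.1 ∈ e ∧ w ∉ X} ⟨u, hue, hdisj u hu⟩
    have hnext : ∀ z : V(H), z.1 ∈ e → π w < π z → G.Adj w z := by
      intro z hz hwz
      refine ⟨e, he, hwe, hz, hwz, le_trans ?_ hle⟩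
      rw [← Subtype.val_injective.encard_image]
      refine Set.encard_le_encard ?_
      rintro _ ⟨y, ⟨hye, hyw⟩, rfl⟩
      have hyX : y ∈ X := by
        by_contra h
        exact hmin y ⟨hye, h⟩ hyw
      exact ⟨⟨hye, (hval _ _).2 (.inl hyX)⟩, fun h => hdisj y ((hval _ _).1 h) hyX⟩
    have : ∃ z ∈ C, z.1 ∈ e ∧ w ≠ z := by
      by_cases h : w = u
      · exact ⟨v, hv, hve, h ▸ huv'⟩
      · exact ⟨u, hu, hue, h⟩
    obtain ⟨z, hz, hze, hwz⟩ := this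
    have hlt : π w < π z := lt_of_le_of_ne (not_lt.1 (hmin z ⟨hze, hdisj z hz⟩))
      (fun h => hwz (π.injective h))
    exact hwX (hcl w z (hnext z hze hlt) (.inr hz))
  · change ∀ D, ((H.trimmed ⊤ _).trimmed ⊤ (Subtype.val '' (X ∪ C) \ Subtype.val '' C)).IsComponent D
      → _
    rw [hSC]
    rintro _ ⟨_, ⟨v, hv, rfl⟩, rfl⟩ hsub
    obtain ⟨s, hs, hsv⟩ := exists_mem_sources hπ v
    have hsJ := (hJ s).2 hs
    exact hcore.2.1 s hsJ fun c hc => hconn_nbhd v hv s hsJ hsv c hc (hsub ((hval _ _).2 hc))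
  · change ∀ c ∈ _, ∃ D,
      ((H.trimmed ⊤ _).trimmed ⊤ (Subtype.val '' (X ∪ C) \ Subtype.val '' C)).IsComponent D ∧ _
    rw [hSC]
    rintro _ ⟨c, hc, rfl⟩
    obtain ⟨s, hs, hsub⟩ := hcore.2.2 c hc
    obtain ⟨a, ha, hac⟩ := Set.exists_ne_of_one_lt_ncard (s := C) (by have := hcore.1; omega) c
    obtain ⟨t, hst, hta⟩ := hsub ⟨ha, hac⟩
    have htJ := hst.mem hs
    obtain ⟨y, hy, hty, -⟩ := hlast a ha t htJ hta
    have htX : t ∈ X := mem_of_mem_reach hXcl hty hy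
    refine ⟨_, ⟨t.1, (hval _ _).2 htX, rfl⟩, ?_, fun h => ?_⟩
    · rintro _ ⟨⟨d, hd, rfl⟩, hdc⟩
      exact hnbhd_conn t htJ d hd (hst.symm.nbhd_subset (hsub ⟨hd, fun h => hdc (congrArg _ h)⟩))
    · have hcs := hst.nbhd_subset (hconn_nbhd t htX t htJ .refl c hc h)
      refine hcore.2.1 s hs fun d hd => ?_
      by_cases hdc : d = c
      · rwa [hdc]
      · exact hsub ⟨hd, hdc⟩

end Hypergraph

/-! ### The Helly property of subtrees -/

/-- The Helly property of subtrees: if a finite set `C` is covered pairwise by the nodes of a tree,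
where for each element the nodes that contain it are connected, then one node covers `C`. A node
`B` with `C ∩ F B` largest will do: if it missed `c ∈ C`, then the node with `c` that is nearest to
`B` would contain `C ∩ F B` as well. -/
lemma SimpleGraph.Connected.exists_subset_of_pairwise {N V : Type*} [Finite N]
    {T : SimpleGraph N} (hT : T.Connected) (F : N → Set V)
    (hF : ∀ (B B₁ B₂ : N) (p : T.Walk B₁ B₂), p.IsPath → B ∈ p.support → F B₁ ∩ F B₂ ⊆ F B)
    {C : Set V} (hC : C.Finite) (hpair : ∀ a ∈ C, ∀ b ∈ C, ∃ B, a ∈ F B ∧ b ∈ F B) :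
    ∃ B, C ⊆ F B := by
  classical
  have := hT.nonempty
  obtain ⟨B, hB⟩ := Finite.exists_max fun B => (C ∩ F B).ncard
  refine ⟨B, fun c hc => ?_⟩
  by_contra hcB
  obtain ⟨B₀, hB₀, -⟩ := hpair c hc c hc
  obtain ⟨B', hcB', hmin⟩ := WellFounded.has_min (InvImage.wf (T.dist B) wellFounded_lt)
    {B' | c ∈ F B'} ⟨B₀, hB₀⟩
  refine (hB B').not_gt (Set.ncard_lt_ncard ⟨fun x hx => ⟨hx.1, ?_⟩, fun h => ?_⟩
    (hC.subset Set.inter_subset_left))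
  · obtain ⟨A, hxA, hcA⟩ := hpair x hx.1 c hc
    obtain ⟨p, hp⟩ := hT.exists_walk_length_eq_dist B B'
    obtain ⟨q, hq⟩ := hT.exists_isPath B' A
    have hpq : (p.append q).IsPath := by
      rw [Walk.isPath_def, Walk.support_append, List.nodup_append']
      refine ⟨(p.isPath_of_length_eq_dist hp).support_nodup, hq.support_nodup.tail, ?_⟩
      intro z hzp hzq
      have hqs := hq.support_nodup
      rw [← Walk.cons_tail_support, List.nodup_cons] at hqs
      have hzB' : z ≠ B' := fun h => hqs.1 (h ▸ hzq)
      have hcz : c ∈ F z := hF z B' A q hq (List.mem_of_mem_tail hzq) ⟨hcB', hcA⟩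
      refine hmin z hcz ?_
      change T.dist B z < T.dist B B'
      rw [← hp]
      exact (dist_le (p.takeUntil z hzp)).trans_lt (p.length_takeUntil_lt_length hzp hzB')
    exact hF B' B A _ hpq (Walk.mem_support_append_iff _ _ |>.2 (.inl p.end_mem_support))
      ⟨hx.2, hxA⟩
  · exact hcB (h ⟨hc, hcB'⟩).2

/-! ### Obstructions give orderings without a decomposition of width one -/

namespace Hypergraph

open Relation Digraph

variable {α : Type*} {H : Hypergraph α} {l : ℕ∞} {S C : Set α}

lemma exists_orientation_of_key (hfin : H.vertexSet.Finite) (key : V(H) → ℕ) :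
    ∃ π : H.Orientation, ∀ u v, key u < key v → π u < π v := by
  have : Finite V(H) := hfin
  let e : V(H) ≃ Fin V(H).ncard := Finite.equivFin V(H)
  let f : Fin V(H).ncard → ℕ := key ∘ e.symm
  refine ⟨e.trans (Tuple.sort f).symm, fun u v huv => ?_⟩
  by_contra! h
  have := Tuple.monotone_sort f h
  simp [f] at this
  omega

/-- An obstruction is witnessed by an ordering that starts with the vertices outside of the core,
by distance from a root in each component, and goes on with the core. The root of a component then
reaches the same core vertices as the component. -/
lemma exists_orientation_one_lt_width (hfin : H.vertexSet.Finite) (hS : S ⊆ V(H))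
    (hobs : H.trimmed ⊤ S ∈ obstructions α l) :
    ∃ π : H.Orientation, ∀ T : (H.skeleton π l).DagTreeDecomposition, 1 < T.width := by
  classical
  have : Finite V(H) := hfin
  obtain ⟨k, C, hk, hCS, hCk, hone, hnot, hall⟩ := hobs
  change C ⊆ S at hCS
  change ∀ D, ((H.trimmed ⊤ S).trimmed ⊤ (S \ C)).IsComponent D → _ at hnot
  change ∀ c ∈ C, ∃ D, ((H.trimmed ⊤ S).trimmed ⊤ (S \ C)).IsComponent D ∧ _ at hall
  set A := ((H.trimmed ⊤ S).trimmed ⊤ (S \ C)).Adj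
  have hAdj : ∀ x y : α, A x y ↔ ∃ e ∈ E(H), x ∈ e ∧ x ∈ S \ C ∧ y ∈ e ∧ y ∈ S \ C := fun x y =>
    trimmed_trimmed_adj Set.sdiff_subset
  let Γ : SimpleGraph V(H) := SimpleGraph.fromRel fun u v => A u.1 v.1
  let root : V(H) → V(H) := fun v => (Γ.connectedComponentMk v).out
  have hroot : ∀ v, Γ.Reachable (root v) v := fun v =>
    SimpleGraph.ConnectedComponent.exact (Quot.out_eq _)
  have hroot_A : ∀ u v : V(H), A u.1 v.1 → root u = root v := by
    intro u v h
    by_cases huv : u = v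
    · rw [huv]
    · have : Γ.Adj u v := by
        rw [SimpleGraph.fromRel_adj]
        exact ⟨huv, .inl h⟩
      simp only [root]
      rw [SimpleGraph.ConnectedComponent.sound this.reachable]
  have hroot_conn : ∀ (v : V(H)) (w : α), ReflTransGen A v.1 w → ∃ h : w ∈ V(H),
      root ⟨w, h⟩ = root v := by
    intro v w h
    induction h with
    | refl => exact ⟨v.2, rfl⟩
    | tail _ h ih =>
      obtain ⟨hb, hbv⟩ := ih
      obtain ⟨e, he, -, -, hce, -⟩ := (hAdj _ _).1 h
      exact ⟨he.subset_vertexSet hce, (hroot_A ⟨_, hb⟩ ⟨_, _⟩ h).symm.trans hbv⟩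
  obtain ⟨M, hM⟩ := (Set.finite_range fun v => Γ.dist (root v) v).bddAbove
  let key : V(H) → ℕ := fun v =>
    if v.1 ∈ S \ C then Γ.dist (root v) v else if v.1 ∈ S then M + 1 else M + 2
  have hkeyX : ∀ v : V(H), v.1 ∈ S \ C → key v = Γ.dist (root v) v := fun v hv => if_pos hv
  have hkeyM : ∀ v : V(H), v.1 ∈ S \ C → key v ≤ M := fun v hv => by
    rw [hkeyX v hv]
    exact hM ⟨v, rfl⟩
  obtain ⟨π, hπ⟩ := exists_orientation_of_key hfin key
  refine ⟨π, ?_⟩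
  set G := H.skeleton π l
  have hGπ : ∀ u v, G.Adj u v → π u < π v := lt_of_skeleton_adj
  have hX_lt : ∀ u v : V(H), u.1 ∈ S \ C → v.1 ∉ S \ C → π u < π v := by
    intro u v hu hv
    refine hπ u v ((hkeyM u hu).trans_lt ?_)
    simp only [key, if_neg hv]
    split_ifs <;> omega
  have hS_lt : ∀ u v : V(H), u.1 ∈ S → v.1 ∉ S → π u < π v := by
    intro u v hu hv
    by_cases huC : u.1 ∈ S \ C
    · exact hX_lt u v huC fun h => hv h.1
    · apply hπ
      have hvC : v.1 ∉ S \ C := fun h => hv h.1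
      simp only [key, if_neg huC, if_neg hvC, if_pos hu, if_neg hv]
      omega
  -- such an edge would come from a hyperedge of arity at least `2` in the trimmed hypergraph on `C`
  have hCC : ∀ u v : V(H), u.1 ∈ C → v.1 ∈ C → ¬ G.Adj u v := by
    rintro u v hu hv ⟨e, he, hue, hve, hlt, hle⟩
    have hmem : e ∩ S ∩ C ∈ E((H.trimmed ⊤ S).trimmed l C) := by
      refine ⟨e ∩ S, ⟨e, he, le_top, ⟨_, hue, hCS hu⟩, rfl⟩, le_trans ?_ hle,
        ⟨_, ⟨hue, hCS hu⟩, hu⟩, rfl⟩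
      rw [← Subtype.val_injective.encard_image]
      refine Set.encard_le_encard ?_
      rintro x ⟨⟨hxe, hxS⟩, hxC⟩
      exact ⟨⟨x, hS hxS⟩, ⟨hxe, hX_lt _ _ ⟨hxS, hxC⟩ fun h => h.2 hu⟩, rfl⟩
    have := Set.encard_le_one_iff.1 (hone _ hmem) u.1 v.1 ⟨⟨hue, hCS hu⟩, hu⟩ ⟨⟨hve, hCS hv⟩, hv⟩
    exact hlt.ne (congrArg π (Subtype.val_injective this))
  -- the root of a component reaches the whole component: every other vertex `w` is adjacent to a
  -- vertex nearer to the root, so the first vertex of a hyperedge that joins the two precedes `w`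
  have hroot_reach : ∀ w : V(H), w.1 ∈ S \ C → w ∈ G.reach (root w) := by
    intro w
    induction hm : π w using WellFoundedLT.induction generalizing w with
    | ind m ih =>
    subst hm
    intro hw
    by_cases hrw : root w = w
    · rw [hrw]
      exact .refl
    -- the vertex before `w` on a shortest walk from the root
    obtain ⟨p, hp⟩ := (hroot w).exists_walk_length_eq_dist
    have hnil : ¬ p.Nil := SimpleGraph.Walk.not_nil_of_ne hrw
    have hzw := p.adj_penultimate hnil
    set z := p.penultimate
    have hdist : Γ.dist (root w) z < Γ.dist (root w) w := by
      have h1 : Γ.dist (root w) z ≤ p.dropLast.length := SimpleGraph.dist_le p.dropLast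
      have h2 := p.length_dropLast_add_one hnil
      omega
    have hA' : A z.1 w.1 := by
      rcases ((SimpleGraph.fromRel_adj _ _ _).1 hzw).2 with h | h
      exacts [h, h.symm]
    obtain ⟨e, he, hze, hzX, hwe, -⟩ := (hAdj _ _).1 hA'
    have hkz : key z < key w := by
      rw [hkeyX z hzX, hkeyX w hw, hroot_A z w hA']
      exact hdist
    obtain ⟨f, hfe, hf⟩ := exists_first (π := π) (l := l) he hze
    have hfz : π f ≤ π z := by
      rcases hf z hze with rfl | h
      exacts [le_rfl, (hGπ _ _ h).le]
    have hfX : f.1 ∈ S \ C := by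
      by_contra h
      exact (hX_lt z f hzX h).not_ge hfz
    have hfw_lt : π f < π w := hfz.trans_lt (hπ _ _ hkz)
    have hfw : G.Adj f w := (hf w hwe).resolve_left fun h => hfw_lt.ne' (congrArg π h)
    have hrf : root f = root w := hroot_A f w ((hAdj _ _).2 ⟨e, he, hfe, hfX, hwe, hw⟩)
    have := ih _ hfw_lt f rfl hfX
    rw [hrf] at this
    exact this.tail hfw
  -- the root of a component reaches the core vertices that the component is attached to
  have hcore_reach : ∀ v : V(H), v.1 ∈ S \ C → ∀ c : V(H), c.1 ∈ C →
      c.1 ∈ ⋃₀ (H.trimmed ⊤ S).connectorEdges C {w ∈ S \ C | ReflTransGen A v.1 w} →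
      c ∈ G.reach (root v) := by
    rintro v hv c hc ⟨_, hf, hcf⟩
    obtain ⟨e, he, rfl, hsub, hcard⟩ := mem_connectorEdges_trimmed.1 hf
    have : ∃ d ∈ e ∩ S, d ∉ C := by
      by_contra! h
      have hmem : e ∩ S ∩ C ∈ E((H.trimmed ⊤ S).trimmed l C) := by
        refine ⟨e ∩ S, ⟨e, he, le_top, ⟨_, hcf⟩, rfl⟩, ?_, ⟨_, hcf, hc⟩, rfl⟩
        rw [Set.sdiff_eq_empty.2 h]
        simp
      have h1 := hone _ hmem
      rw [Set.inter_eq_left.2 h] at h1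
      exact h1.not_gt hcard
    obtain ⟨d, ⟨hde, hdS⟩, hdC⟩ := this
    obtain ⟨f, hfe, hf⟩ := exists_first (π := π) (l := l) he hde
    have hfd : π f ≤ π ⟨d, hS hdS⟩ := by
      rcases hf ⟨d, hS hdS⟩ hde with h | h
      exacts [(congrArg π h).ge, (hGπ _ _ h).le]
    have hfX : f.1 ∈ S \ C := by
      by_contra h
      exact (hX_lt ⟨d, hS hdS⟩ f ⟨hdS, hdC⟩ h).not_ge hfd
    have hfD := (hsub ⟨hfe, hfX.1⟩).resolve_left hfX.2
    have hfc : G.Adj f c := (hf c hcf.1).resolve_left fun h => hfX.2 (h ▸ hc)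
    obtain ⟨_, hrf⟩ := hroot_conn v f.1 hfD.2
    have := hroot_reach f hfX
    rw [hrf] at this
    exact this.tail hfc
  -- conversely, no vertex of a component reaches another component or other core vertices
  have hreach_core : ∀ s : V(H), s.1 ∈ S \ C → ∀ w, w ∈ G.reach s → w.1 ∈ S →
      w.1 ∈ S \ C ∧ ReflTransGen A s.1 w.1 ∨ w.1 ∈ C ∧
        w.1 ∈ ⋃₀ (H.trimmed ⊤ S).connectorEdges C {w ∈ S \ C | ReflTransGen A s.1 w} := by
    intro s hs w hw
    induction hw with
    | refl => exact fun _ => .inl ⟨hs, .refl⟩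
    | @tail b c _ hbc ih =>
      intro hcS
      have hbS : b.1 ∈ S := by
        by_contra h
        exact (hGπ _ _ hbc).not_gt (hS_lt c b hcS h)
      rcases ih hbS with ⟨hbX, hsb⟩ | ⟨hbC, -⟩
      · obtain ⟨e, he, hbe, hce, hlt, -⟩ := hbc
        by_cases hcC : c.1 ∈ C
        · refine .inr ⟨hcC, e ∩ S, mem_connectorEdges_trimmed.2 ⟨e, he, rfl, ?_, ?_⟩, hce, hcS⟩
          · rintro x ⟨hxe, hxS⟩
            by_cases hxC : x ∈ C
            · exact .inl hxC
            · exact .inr ⟨⟨hxS, hxC⟩, hsb.tail ((hAdj _ _).2 ⟨e, he, hbe, hbX, hxe, hxS, hxC⟩)⟩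
          · exact Set.one_lt_encard_iff.2 ⟨b.1, c.1, ⟨hbe, hbS⟩, ⟨hce, hcS⟩,
              fun h => hbX.2 (h ▸ hcC)⟩
        · exact .inl ⟨⟨hcS, hcC⟩,
            hsb.tail ((hAdj _ _).2 ⟨e, he, hbe, hbX, hce, hcS, hcC⟩)⟩
      · exfalso
        by_cases hcC : c.1 ∈ C
        · exact hCC b c hbC hcC hbc
        · exact (hGπ _ _ hbc).not_gt (hX_lt c b ⟨hcS, hcC⟩ fun h => h.2 hbC)
  -- within `S`, core vertices reach themselves only, and vertices outside of `S` reach nothing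
  have hreach_other : ∀ s : V(H), s.1 ∉ S \ C → ∀ w, w ∈ G.reach s → w = s ∨ w.1 ∉ S := by
    intro s hs w hw
    induction hw with
    | refl => exact .inl rfl
    | @tail b c _ hbc ih =>
      right
      intro hcS
      have hbS : b.1 ∈ S := by
        by_contra h
        exact (hGπ _ _ hbc).not_gt (hS_lt c b hcS h)
      obtain rfl := ih.resolve_right (not_not.2 hbS)
      have hbC : b.1 ∈ C := by
        by_contra h
        exact hs ⟨hbS, h⟩
      by_cases hcC : c.1 ∈ C
      · exact hCC b c hbC hcC hbc
      · exact (hGπ _ _ hbc).not_gt (hX_lt c b ⟨hcS, hcC⟩ hs)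
  have hncard : C.ncard = k := by rw [Set.ncard, hCk, ENat.toNat_natCast]
  have hCfin : C.Finite := hfin.subset (hCS.trans hS)
  intro T
  by_contra! hwidth
  obtain ⟨B, hB⟩ := T.isTree.connected.exists_subset_of_pairwise (fun B => G.reachSet B.1)
    T.reach_inter (C := {c : V(H) | c.1 ∈ C}) (Set.toFinite _) (by
      intro a ha b hb
      obtain ⟨c, hc, hcab⟩ : ∃ c ∈ C, c ∉ ({a.1, b.1} : Set α) := by
        refine Set.exists_mem_notMem_of_ncard_lt_ncard ?_ (Set.toFinite _)
        have := Set.ncard_insert_le a.1 {b.1}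
        rw [Set.ncard_singleton] at this
        omega
      simp only [Set.mem_insert_iff, Set.mem_singleton_iff, not_or] at hcab
      obtain ⟨_, ⟨v, hv, rfl⟩, hsub, -⟩ := hall c hc
      have hv' : v ∈ S \ C := hv
      have key' : ∀ d : V(H), d.1 ∈ C → c ≠ d.1 → d ∈ G.reach (root ⟨v, hS hv'.1⟩) :=
        fun d hd hcd => hcore_reach ⟨v, hS hv'.1⟩ hv' d hd (hsub ⟨hd, fun h => hcd h.symm⟩)
      obtain ⟨s, hs, hsr⟩ := exists_mem_sources hGπ (root ⟨v, hS hv'.1⟩)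
      obtain ⟨B, hB⟩ := T.cover s hs
      exact ⟨B, Set.mem_biUnion hB (hsr.trans (key' a ha hcab.1)),
        Set.mem_biUnion hB (hsr.trans (key' b hb hcab.2))⟩)
  obtain ⟨a, ha, b, hb, hab⟩ := (Set.one_lt_ncard hCfin).1 (by omega)
  obtain ⟨s, hs, -⟩ := Set.mem_iUnion₂.1 (hB (a := ⟨a, hS (hCS ha)⟩) ha)
  have hsB : ∀ t ∈ B.1, t = s := fun t ht =>
    Finset.card_le_one.1 ((Finset.le_sup (f := Finset.card) B.2).trans hwidth) t ht s hs
  have hsC : ∀ c : V(H), c.1 ∈ C → c ∈ G.reach s := by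
    intro c hc
    obtain ⟨t, ht, htc⟩ := Set.mem_iUnion₂.1 (hB hc)
    rwa [hsB t ht] at htc
  by_cases hsX : s.1 ∈ S \ C
  · refine hnot {w ∈ S \ C | ReflTransGen A s.1 w} ⟨s.1, hsX, rfl⟩ fun c hc => ?_
    rcases hreach_core s hsX ⟨c, hS (hCS hc)⟩ (hsC _ hc) (hCS hc) with h | h
    exacts [absurd hc h.1.2, h.2]
  · have h1 := (hreach_other s hsX _ (hsC ⟨a, hS (hCS ha)⟩ ha)).resolve_right (not_not.2 (hCS ha))
    have h2 := (hreach_other s hsX _ (hsC ⟨b, hS (hCS hb)⟩ hb)).resolve_right (not_not.2 (hCS hb))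
    exact hab (congrArg Subtype.val (h1.trans h2.symm))

end Hypergraph

/-! ### The characterization of treewidth one -/

theorem mainTheorem3 {α : Type*} (l : ℕ∞) (H : Hypergraph α)
    (hfin : H.vertexSet.Finite) (hne : H.vertexSet.Nonempty) :
    H.lDagTreewidth l = 1 ↔ H.ITSFree (Hypergraph.obstructions α l) := by
  classical
  have hfin' : Finite V(H) := hfin
  constructor
  · intro h S hS hobs
    obtain ⟨π, hπ⟩ := Hypergraph.exists_orientation_one_lt_width hfin hS hobs
    have h1 : (H.skeleton π l).dagTreewidth < 2 := by
      refine lt_of_le_of_lt ?_ (show (1 : ℕ∞) < 2 by exact_mod_cast Nat.one_lt_two)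
      rw [← h]
      exact le_iSup (fun π : H.Orientation => (H.skeleton π l).dagTreewidth) π
    obtain ⟨T, hT⟩ := iInf_lt_iff.1 h1
    have : T.width < 2 := by exact_mod_cast hT
    exact absurd (hπ T) (by omega)
  · intro hfree
    obtain ⟨v, hv⟩ := hne
    refine le_antisymm (iSup_le fun π => ?_) ?_
    · let J : Finset V(H) := (Set.toFinite (H.skeleton π l).sources).toFinset
      have hJ : ∀ s, s ∈ J ↔ s ∈ (H.skeleton π l).sources := fun s => Set.Finite.mem_toFinset _
      obtain ⟨r, hr, -⟩ := Digraph.exists_mem_sources (D := H.skeleton π l) (π := π)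
        Hypergraph.lt_of_skeleton_adj ⟨v, hv⟩
      have hno : ∀ C X, ¬ SetFamily.IsCore (H.skeleton π l).reach J C X := by
        intro C X hcore
        obtain ⟨C, X, hcore, hcl⟩ := Digraph.exists_isCore_closed
          Hypergraph.lt_of_skeleton_adj hcore
        refine hfree _ ?_ (Hypergraph.trimmed_mem_obstructions hfin' hJ hcore hcl)
        rintro _ ⟨u, -, rfl⟩
        exact u.2
      obtain ⟨T, hT⟩ := Digraph.exists_width_le_one_of_earOrder hJ ((hJ r).2 hr)
        (SetFamily.earOrder_of_forall_not_isCore J hno ((hJ r).2 hr))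
      exact (iInf_le _ T).trans (by exact_mod_cast hT)
    · obtain ⟨π, -⟩ := Hypergraph.exists_orientation_of_key hfin fun _ => 0
      refine le_trans (le_iInf fun T => ?_) 
        (le_iSup (fun π : H.Orientation => (H.skeleton π l).dagTreewidth) π)
      obtain ⟨s, hs, -⟩ := Digraph.exists_mem_sources (D := H.skeleton π l) (π := π)
        Hypergraph.lt_of_skeleton_adj ⟨v, hv⟩
      obtain ⟨B, hB⟩ := T.cover s hs
      have : 1 ≤ T.width := (Nat.succ_le_of_lt (Finset.card_pos.2 ⟨s, hB⟩)).trans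
        (Finset.le_sup (f := Finset.card) B.2)
      exact_mod_cast this
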